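/- **Theorem (Improved Spectral Norm Bound for Kikuchi Matrices, even $r$).** Let $r>2$ be even. There exist constants $\delta>0$ and $C>0$, depending only on $r$, and a sequence $\varepsilon(n)\to 0$ as $n\to\infty$, such that the following holds for all $n,\ell\in\mathbb{N}$ with $\ell<n^{\delta}$. Let $G$ be a random symmetric tensor of order $r$ on $[n]$ whose entries $G_S$, for $S\in\binom{[n]}{r}$, are i.i.d. $N(0,1)$, and let $M_\ell(G)$ be its level-$\ell$ Kikuchi matrix, that is, the matrix with rows and columns indexed by the $\ell$-element subsets of $[n]$ and entries $$M_\ell(G)[I,J]=\begin{cases}G_{I\Delta J} & \text{if } |I\Delta J|=r,\\ 0 & \text{otherwise.}\end{cases}$$ Then, with probability at least $1-\varepsilon(n)$, $$\|M_\ell(G)\|_{sp}\;\le\; C\cdot\left(\sqrt{n\,\ell}\right)^{r/2}\cdot\sqrt{\ell},$$ where $\|\cdot\|_{sp}$ is the spectral norm (the operator norm with respect to the Euclidean norm). -/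

import Mathlib

open MeasureTheory ProbabilityTheory Filter Topology

namespace Kikuchi

/-- A real tensor of order `r` on `[n]`, as the array of its entries. -/
abbrev Tensor (n r : ℕ) : Type := (Fin r → Fin n) → ℝ

/-- A tensor is symmetric if its entries do not change when the indices are permuted. -/
def Tensor.IsSymmetric {n r : ℕ} (T : Tensor n r) : Prop :=
  ∀ (σ : Equiv.Perm (Fin r)) (i : Fin r → Fin n), T (i ∘ σ) = T i

/-- The subsets of `[n]` with exactly `k` elements. -/
abbrev Subsets (n k : ℕ) : Type := {S : Finset (Fin n) // S.card = k}

/-- The entry `T_S` of a tensor at an `r`-element subset `S`: the entry at the elements of `S`,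
listed increasingly. For a symmetric tensor the order of the listing is irrelevant. -/
def Tensor.entry {n r : ℕ} (T : Tensor n r) (S : Subsets n r) : ℝ :=
  T (S.1.orderEmbOfFin S.2)

/-- For a symmetric tensor, `T_S` is the entry at any listing of the elements of `S`. -/
theorem Tensor.IsSymmetric.entry_eq {n r : ℕ} {T : Tensor n r} (hT : T.IsSymmetric)
    (S : Subsets n r) (e : Fin r ≃ S.1) : T (fun k => (e k : Fin n)) = T.entry S := by
  have h := hT (e.trans (S.1.orderIsoOfFin S.2).toEquiv.symm) (S.1.orderEmbOfFin S.2)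
  rw [Tensor.entry, ← h]
  congr 1
  funext k
  simp [← Finset.coe_orderIsoOfFin_apply]

/-- The level-`ℓ` Kikuchi matrix of a tensor of (even) order `r`: rows and columns are indexed by
the `ℓ`-element subsets of `[n]`, and the entry at `(I, J)` is `T_{I ∆ J}` if `|I ∆ J| = r`, and `0`
otherwise. -/
def kikuchiMatrix {n r : ℕ} (ℓ : ℕ) (T : Tensor n r) :
    Matrix (Subsets n ℓ) (Subsets n ℓ) ℝ :=
  Matrix.of fun I J =>
    if h : (symmDiff I.1 J.1).card = r then T.entry ⟨symmDiff I.1 J.1, h⟩ else 0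

/-- The spectral norm of a square real matrix: its operator norm on Euclidean space. -/
noncomputable def specNorm {m : Type*} [Fintype m] [DecidableEq m] (A : Matrix m m ℝ) : ℝ :=
  ‖Matrix.toEuclideanCLM (n := m) (𝕜 := ℝ) A‖

/-- `G` is a random symmetric tensor whose entries `G_S`, over the `r`-element subsets `S` of `[n]`,
are independent standard Gaussian random variables. -/
structure IsGaussianSymmetricTensor {Ω : Type*} [MeasurableSpace Ω] {n r : ℕ}
    (G : Ω → Tensor n r) (P : Measure Ω) : Prop where
  symmetric : ∀ ω, (G ω).IsSymmetric
  hasLaw : ∀ S : Subsets n r, HasLaw (fun ω => (G ω).entry S) (gaussianReal 0 1) P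
  indep : iIndepFun (fun (S : Subsets n r) ω => (G ω).entry S) P

end Kikuchi

namespace Kikuchi

/-! ### Moments of Gaussian monomials -/

/-! The proof is the trace method. With `r = 2k`, the expected trace of `M ^ K` is a sum over closed
walks of length `K` on `ℓ`-subsets, weighted by Gaussian moments of the multiplicities of the steps
`S = I ∆ J`. A step opens `S` if its multiplicity so far is even and closes it if odd. An opening
step has about `(ℓ n) ^ k` choices; a closing step costs the current multiplicity of `S`.

The key point is that the closing costs add up to about `ℓ`, not to the length of the walk: the step
must meet the current vertex, and each of its `ℓ` elements lies in at most one open set, unless it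
was brought in by an opening step after having been met before. If `F` counts such re-entries, the
closing cost is at most `ℓ + 4F` (`WalkInvariant.sum_odd_le`), hence at most `ℓ * y ^ F`. A
re-entering element has at most `V` choices instead of `n`, which pays for the powers of `y` as long
as `V * y ^ K ≤ n`.

Balancing the two kinds of steps gives a factor `2s` per step, where `s ^ 2 = ℓ * (2nℓ) ^ k`
(`integral_monomial_mul_pow_le`). Taking `K` of order `ℓ log n` absorbs the at most `n ^ ℓ` starting
vertices in Markov's inequality. -/

/-- `∫ x ^ (k + 2) = (k + 1) ∫ x ^ k` for the standard Gaussian measure. -/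
theorem integral_pow_add_two_gaussianReal (k : ℕ) :
    ∫ x, x ^ (k + 2) ∂(gaussianReal 0 1) = (k + 1) * ∫ x, x ^ k ∂(gaussianReal 0 1) := by
  have hint : ∀ j : ℕ, Integrable (fun x : ℝ => x ^ j * Real.exp (-x ^ 2 / 2)) := fun j => by
    have h := integrable_rpow_mul_exp_neg_mul_sq (b := 1 / 2) (by norm_num) (s := j)
      (by have : (0 : ℝ) ≤ j := Nat.cast_nonneg j
          linarith)
    simp only [Real.rpow_natCast] at h
    refine h.congr (Eventually.of_forall fun x => ?_)
    simp only
    congr 2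
    ring
  have key : ∀ j : ℕ, ∫ x, x ^ j ∂(gaussianReal 0 1) =
      (√(2 * Real.pi))⁻¹ * ∫ x : ℝ, x ^ j * Real.exp (-x ^ 2 / 2) := fun j => by
    rw [integral_gaussianReal_eq_integral_smul one_ne_zero, ← integral_const_mul]
    refine integral_congr_ae (Eventually.of_forall fun x => ?_)
    simp only [gaussianPDFReal, smul_eq_mul, NNReal.coe_one, mul_one, sub_zero]
    ring
  have parts := integral_mul_deriv_eq_deriv_mul_of_integrable
    (u := fun x : ℝ => x ^ (k + 1)) (u' := fun x : ℝ => (k + 1) * x ^ k)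
    (v := fun x : ℝ => -Real.exp (-x ^ 2 / 2)) (v' := fun x : ℝ => x * Real.exp (-x ^ 2 / 2))
    (fun x _ => by simpa using hasDerivAt_pow (k + 1) x)
    (fun x _ => by
      have h := ((((hasDerivAt_pow 2 x).neg).div_const 2).exp).neg
      refine h.congr_deriv ?_
      simp
      ring)
    ((hint (k + 2)).congr (Eventually.of_forall fun x => by simp only [Pi.mul_apply]; ring))
    (((hint k).const_mul (-((k : ℝ) + 1))).congr
      (Eventually.of_forall fun x => by simp only [Pi.mul_apply]; ring))
    ((hint (k + 1)).neg.congr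
      (Eventually.of_forall fun x => by simp only [Pi.mul_apply, Pi.neg_apply]; ring))
  have h1 : ∫ x : ℝ, x ^ (k + 2) * Real.exp (-x ^ 2 / 2) =
      (k + 1) * ∫ x : ℝ, x ^ k * Real.exp (-x ^ 2 / 2) := by
    rw [← integral_const_mul]
    calc _ = ∫ x : ℝ, x ^ (k + 1) * (x * Real.exp (-x ^ 2 / 2)) := by
          congr 1; funext x; ring
      _ = _ := by
          rw [parts, ← integral_neg]
          congr 1; funext x; ring
  rw [key, key, h1]
  ring

theorem integrable_pow_gaussianReal (k : ℕ) :
    Integrable (fun x : ℝ => x ^ k) (gaussianReal 0 1) := by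
  rcases Nat.eq_zero_or_pos k with rfl | hk
  · simp
  have h := (memLp_id_gaussianReal (μ := 0) (v := 1) k).integrable_norm_pow (by omega)
  refine h.mono' (by fun_prop) (Eventually.of_forall fun x => by simp)

/-- A majorant for the moments of the standard Gaussian: it is the `k`-th moment times `1` for even
`k`, and positive for odd `k`. -/
noncomputable def momentWeight (x : ℝ) : ℕ → ℝ
  | 0 => 1
  | k + 1 => momentWeight x k * if Even k then x else k / x

theorem momentWeight_nonneg {x : ℝ} (hx : 0 < x) (k : ℕ) : 0 ≤ momentWeight x k := by
  induction k with
  | zero => simp [momentWeight]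
  | succ k ih =>
    rw [momentWeight]
    split_ifs <;> positivity

theorem integral_pow_gaussianReal_mem {x : ℝ} (hx : 0 < x) (k : ℕ) :
    0 ≤ ∫ t, t ^ k ∂(gaussianReal 0 1) ∧
      ∫ t, t ^ k ∂(gaussianReal 0 1) ≤ momentWeight x k := by
  induction k using Nat.twoStepInduction with
  | zero => simp [momentWeight]
  | one =>
    simp only [pow_one, momentWeight]
    have : ∫ t : ℝ, t ∂(gaussianReal 0 1) = 0 := integral_id_gaussianReal
    simp [this, hx.le]
  | more k ih _ =>
    rw [integral_pow_add_two_gaussianReal]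
    refine ⟨mul_nonneg (by positivity) ih.1, ?_⟩
    have h0 := momentWeight_nonneg hx k
    rcases Nat.even_or_odd k with he | ho
    -- For even `k` the factors `x` and `(k + 1) / x` cancel, leaving the moment recursion.
    · have : momentWeight x (k + 2) = (k + 1) * momentWeight x k := by
        simp only [momentWeight, he, if_true, Nat.even_add_one, not_true_eq_false, if_false]
        push_cast
        field_simp
      rw [this]
      exact mul_le_mul_of_nonneg_left ih.2 (by positivity)
    · have hz : ∀ j : ℕ, ∫ t, t ^ (2 * j + 1) ∂(gaussianReal 0 1) = 0 := fun j => by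
        induction j with
        | zero => simp
        | succ j ih =>
          rw [show 2 * (j + 1) + 1 = (2 * j + 1) + 2 by ring, integral_pow_add_two_gaussianReal, ih,
            mul_zero]
      obtain ⟨j, rfl⟩ := ho
      rw [hz, mul_zero]
      exact momentWeight_nonneg hx _

variable {Ω ι : Type*} [MeasurableSpace Ω] [Fintype ι] {P : Measure Ω} {X : ι → Ω → ℝ}

theorem integrable_prod_pow (hlaw : ∀ i, HasLaw (X i) (gaussianReal 0 1) P) (hind : iIndepFun X P)
    (m : ι → ℕ) : Integrable (fun ω => ∏ i, X i ω ^ m i) P := by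
  have := hind.isProbabilityMeasure
  have hae : ∀ i, AEMeasurable (X i) P := fun i => (hlaw i).aemeasurable
  have h : Integrable (fun x : ι → ℝ => ∏ i, x i ^ m i) (P.map fun ω i => X i ω) := by
    rw [hind.map_fun_eq_pi_map hae]
    simp only [(hlaw _).map_eq]
    exact Integrable.fintype_prod (f := fun i (x : ℝ) => x ^ m i)
      fun i => integrable_pow_gaussianReal (m i)
  exact h.comp_aemeasurable (by fun_prop)

theorem integral_prod_pow_mem (hlaw : ∀ i, HasLaw (X i) (gaussianReal 0 1) P)
    (hind : iIndepFun X P) (m : ι → ℕ) {x : ℝ} (hx : 0 < x) :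
    0 ≤ ∫ ω, ∏ i, X i ω ^ m i ∂P ∧
      ∫ ω, ∏ i, X i ω ^ m i ∂P ≤ ∏ i, momentWeight x (m i) := by
  have h : ∫ ω, ∏ i, X i ω ^ m i ∂P = ∏ i, ∫ t, t ^ m i ∂(gaussianReal 0 1) := by
    rw [hind.integral_fun_prod_comp (f := fun i (t : ℝ) => t ^ m i)
      (fun i => (hlaw i).aemeasurable) (fun i => by fun_prop)]
    refine Finset.prod_congr rfl fun i _ => ?_
    rw [← (hlaw i).map_eq, integral_map (hlaw i).aemeasurable (by fun_prop)]
  rw [h]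
  exact ⟨Finset.prod_nonneg fun i _ => (integral_pow_gaussianReal_mem hx _).1,
    Finset.prod_le_prod (fun i _ => (integral_pow_gaussianReal_mem hx _).1)
      fun i _ => (integral_pow_gaussianReal_mem hx _).2⟩

/-! ### The spectral norm and the trace of powers -/

/-- The C⋆-identity gives equality for exponents `2 ^ k`; splitting off `a ^ k` and cancelling the
remaining power of `‖a‖` reaches every exponent. -/
theorem norm_pow_le_of_isSelfAdjoint {E : Type*} [NormedRing E] [StarRing E] [CStarRing E]
    {a : E} (ha : IsSelfAdjoint a) {k : ℕ} (hk : 0 < k) : ‖a‖ ^ k ≤ ‖a ^ k‖ := by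
  rcases (norm_nonneg a).eq_or_lt with h0 | hpos
  · rw [← h0, zero_pow hk.ne']
    exact norm_nonneg _
  obtain ⟨j, hj⟩ : ∃ j, 2 ^ k = k + (j + 1) :=
    ⟨2 ^ k - k - 1, by have := Nat.lt_two_pow_self (n := k); omega⟩
  have h := ha.norm_pow_two_pow k
  rw [hj, pow_add a] at h
  have h1 : ‖a‖ ^ k * ‖a‖ ^ (j + 1) ≤ ‖a ^ k‖ * ‖a‖ ^ (j + 1) := by
    rw [← pow_add, ← h]
    exact (norm_mul_le _ _).trans
      (mul_le_mul_of_nonneg_left (norm_pow_le' a j.succ_pos) (norm_nonneg _))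
  exact le_of_mul_le_mul_right h1 (pow_pos hpos _)

theorem specNorm_sq_le_sum_sq {m : Type*} [Fintype m] [DecidableEq m] (A : Matrix m m ℝ) :
    specNorm A ^ 2 ≤ ∑ i, ∑ j, A i j ^ 2 := by
  have hnn : 0 ≤ ∑ i, ∑ j, A i j ^ 2 :=
    Finset.sum_nonneg fun i _ => Finset.sum_nonneg fun j _ => sq_nonneg _
  have h : specNorm A ≤ √(∑ i, ∑ j, A i j ^ 2) := by
    refine ContinuousLinearMap.opNorm_le_bound _ (Real.sqrt_nonneg _) fun x => ?_
    rw [EuclideanSpace.norm_eq, EuclideanSpace.norm_eq, ← Real.sqrt_mul hnn]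
    refine Real.sqrt_le_sqrt ?_
    simp only [Real.norm_eq_abs, sq_abs, Matrix.ofLp_toEuclideanCLM, Matrix.mulVec, dotProduct]
    rw [Finset.sum_mul]
    exact Finset.sum_le_sum fun i _ => Finset.sum_mul_sq_le_sq_mul_sq _ _ _
  calc specNorm A ^ 2 ≤ √(∑ i, ∑ j, A i j ^ 2) ^ 2 :=
        pow_le_pow_left₀ (norm_nonneg _) h 2
    _ = _ := Real.sq_sqrt hnn

/-- For symmetric `A`, the trace is the squared Frobenius norm of `A ^ p`. -/
theorem specNorm_pow_le_trace {m : Type*} [Fintype m] [DecidableEq m] {A : Matrix m m ℝ}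
    (hA : A.IsSymm) {p : ℕ} (hp : 0 < p) : specNorm A ^ (2 * p) ≤ (A ^ (2 * p)).trace := by
  have hsa : IsSelfAdjoint (Matrix.toEuclideanCLM (n := m) (𝕜 := ℝ) A) := by
    rw [IsSelfAdjoint, ← map_star, Matrix.star_eq_conjTranspose,
      Matrix.conjTranspose_eq_transpose_of_trivial, hA.eq]
  have h1 : specNorm A ^ p ≤ specNorm (A ^ p) := by
    have := norm_pow_le_of_isSelfAdjoint (E := EuclideanSpace ℝ m →L[ℝ] EuclideanSpace ℝ m) hsa hp
    rwa [← map_pow] at this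
  calc specNorm A ^ (2 * p) = (specNorm A ^ p) ^ 2 := by rw [mul_comm, pow_mul]
    _ ≤ specNorm (A ^ p) ^ 2 := pow_le_pow_left₀ (pow_nonneg (norm_nonneg _) _) h1 2
    _ ≤ ∑ i, ∑ j, (A ^ p) i j ^ 2 := specNorm_sq_le_sum_sq _
    _ = (A ^ (2 * p)).trace := by
      rw [two_mul, pow_add, Matrix.trace]
      refine Finset.sum_congr rfl fun i _ => ?_
      rw [Matrix.diag_apply, Matrix.mul_apply]
      refine Finset.sum_congr rfl fun j _ => ?_
      rw [sq, (hA.pow p).apply j i]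

end Kikuchi

namespace Kikuchi

/-! ### Combinatorics of walks -/

-- Each squarefree monomial occurs in the expansion of the power, whose other terms are nonnegative.
open Finset in
theorem sum_powersetCard_prod_le {α : Type*} [DecidableEq α] (w : α → ℝ) (hw : ∀ a, 0 ≤ w a)
    (s : Finset α) (k : ℕ) :
    ∑ B ∈ s.powersetCard k, ∏ a ∈ B, w a ≤ (∑ a ∈ s, w a) ^ k := by
  induction s using Finset.induction_on generalizing k with
  | empty =>
    cases k with
    | zero => simp
    | succ k => rw [powersetCard_eq_empty.2 (by simp)]; simp
  | insert a s ha ih =>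
    cases k with
    | zero => simp
    | succ k =>
      have hs : 0 ≤ ∑ a ∈ s, w a := sum_nonneg fun _ _ => hw _
      have hdisj : Disjoint (powersetCard (k + 1) s) ((powersetCard k s).image (insert a)) := by
        rw [Finset.disjoint_left]
        intro B hB hB'
        obtain ⟨B', -, rfl⟩ := mem_image.1 hB'
        exact ha ((mem_powersetCard.1 hB).1 (mem_insert_self _ _))
      have hnot : ∀ B ∈ powersetCard k s, a ∉ B := fun B hB h => ha ((mem_powersetCard.1 hB).1 h)
      rw [powersetCard_succ_insert ha, sum_union hdisj, sum_insert ha, sum_image]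
      · calc _ = ∑ B ∈ powersetCard (k + 1) s, ∏ i ∈ B, w i +
              w a * ∑ B ∈ powersetCard k s, ∏ i ∈ B, w i := by
              rw [mul_sum]
              congr 1
              exact sum_congr rfl fun B hB => prod_insert (hnot B hB)
          _ ≤ (∑ i ∈ s, w i) ^ (k + 1) + w a * (∑ i ∈ s, w i) ^ k :=
              add_le_add (ih _) (mul_le_mul_of_nonneg_left (ih _) (hw a))
          _ = (w a + ∑ i ∈ s, w i) * (∑ i ∈ s, w i) ^ k := by ring
          _ ≤ (w a + ∑ i ∈ s, w i) * (w a + ∑ i ∈ s, w i) ^ k := by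
              have := hw a
              gcongr
              linarith
          _ = _ := by ring
      · intro B hB B' hB' h
        rw [← erase_insert (hnot B hB), ← erase_insert (hnot B' hB'), h]

variable {n r ℓ : ℕ}

theorem card_sdiff_of_card_symmDiff {k : ℕ} {I J : Finset (Fin n)} (hIJ : I.card = J.card)
    (h : (symmDiff I J).card = 2 * k) : (I \ J).card = k ∧ (J \ I).card = k := by
  have h1 : (I \ J).card = (J \ I).card := Finset.card_sdiff_comm hIJ
  have h2 : (symmDiff I J).card = (I \ J).card + (J \ I).card := by
    rw [symmDiff, Finset.sup_eq_union, Finset.card_union_of_disjoint disjoint_sdiff_sdiff]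
  omega

/-- Weighted count of the neighbours of a vertex of the Kikuchi graph, by the number of entering
elements which lie in `V`. -/
theorem sum_neighbours_pow_le {k : ℕ} (I : Subsets n ℓ) (V : Finset (Fin n)) {z : ℝ} (hz : 1 ≤ z) :
    ∑ J : Subsets n ℓ, (if (symmDiff I.1 J.1).card = 2 * k then z ^ ((J.1 \ I.1) ∩ V).card else 0) ≤
      (ℓ : ℝ) ^ k * (n + V.card * z) ^ k := by
  have hz0 : 0 ≤ z := by linarith
  set w : Fin n → ℝ := fun a => if a ∈ V then z else 1 with hw
  have hw0 : ∀ a, 0 ≤ w a := fun a => by simp only [hw]; split_ifs <;> linarith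
  have hprod : ∀ B : Finset (Fin n), ∏ a ∈ B, w a = z ^ (B ∩ V).card := fun B => by
    simp only [hw, Finset.prod_ite, Finset.prod_const, one_pow, mul_one, Finset.filter_mem_eq_inter]
  have hsum : ∑ a, w a ≤ n + V.card * z := by
    have h : ∀ a, w a ≤ 1 + if a ∈ V then z else 0 := fun a => by
      simp only [hw]; split_ifs <;> linarith
    refine (Finset.sum_le_sum fun a _ => h a).trans ?_
    simp [Finset.sum_add_distrib]
  rw [← Finset.sum_filter]
  -- A neighbour `J` is determined by the `k` elements leaving `I` and the `k` entering ones.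
  calc _ = ∑ q ∈ (Finset.univ.filter fun J : Subsets n ℓ => (symmDiff I.1 J.1).card = 2 * k).image
            (fun J => (I.1 \ J.1, J.1 \ I.1)), z ^ (q.2 ∩ V).card := by
        rw [Finset.sum_image]
        intro J _ J' _ h
        simp only [Prod.mk.injEq] at h
        ext a
        have h1 := congrArg (a ∈ ·) h.1
        have h2 := congrArg (a ∈ ·) h.2
        simp only [Finset.mem_sdiff, eq_iff_iff] at h1 h2
        tauto
    _ ≤ ∑ q ∈ I.1.powersetCard k ×ˢ (Finset.univ : Finset (Fin n)).powersetCard k,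
          z ^ (q.2 ∩ V).card := by
        refine Finset.sum_le_sum_of_subset_of_nonneg ?_ fun _ _ _ => pow_nonneg hz0 _
        intro q hq
        obtain ⟨J, hJ, rfl⟩ := Finset.mem_image.1 hq
        have h := card_sdiff_of_card_symmDiff (I.2.trans J.2.symm) (Finset.mem_filter.1 hJ).2
        simp [Finset.mem_powersetCard, h.1, h.2]
    _ = (ℓ.choose k : ℝ) * ∑ B ∈ (Finset.univ : Finset (Fin n)).powersetCard k, ∏ a ∈ B, w a := by
        rw [Finset.sum_product]
        simp [hprod, Finset.card_powersetCard, I.2]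
    _ ≤ (ℓ : ℝ) ^ k * (n + V.card * z) ^ k := by
        have h1 : (ℓ.choose k : ℝ) ≤ (ℓ : ℝ) ^ k := by exact_mod_cast Nat.choose_le_pow ℓ k
        have h2 := sum_powersetCard_prod_le w hw0 Finset.univ k
        have h3 : 0 ≤ ∑ a, w a := Finset.sum_nonneg fun _ _ => hw0 _
        refine mul_le_mul h1 (h2.trans (pow_le_pow_left₀ h3 hsum k)) ?_ (by positivity)
        exact Finset.sum_nonneg fun _ _ => Finset.prod_nonneg fun _ _ => hw0 _

theorem sum_neighbours_le (I : Subsets n ℓ) (f : Subsets n r → ℕ) :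
    ∑ J : Subsets n ℓ, (if h : (symmDiff I.1 J.1).card = r then f ⟨symmDiff I.1 J.1, h⟩ else 0) ≤
      ∑ S, f S := by
  calc _ = ∑ J : Subsets n ℓ, ∑ S : Subsets n r, if symmDiff I.1 J.1 = S.1 then f S else 0 := by
        refine Finset.sum_congr rfl fun J _ => ?_
        split_ifs with h
        · rw [Finset.sum_eq_single ⟨symmDiff I.1 J.1, h⟩]
          · simp
          · intro S _ hS
            rw [if_neg]
            intro h'
            exact hS (Subtype.ext h'.symm)
          · simp
        · symm
          refine Finset.sum_eq_zero fun S _ => if_neg fun h' => h ?_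
          rw [h', S.2]
    _ = ∑ S : Subsets n r, ∑ J : Subsets n ℓ, if symmDiff I.1 J.1 = S.1 then f S else 0 :=
        Finset.sum_comm
    _ ≤ ∑ S, f S := by
        refine Finset.sum_le_sum fun S _ => ?_
        rw [← Finset.sum_filter, Finset.sum_const, smul_eq_mul]
        refine (Nat.mul_le_mul_right _ (Finset.card_le_one.2 ?_)).trans_eq (one_mul _)
        intro J hJ J' hJ'
        simp only [Finset.mem_filter, Finset.mem_univ, true_and] at hJ hJ'
        exact Subtype.ext (symmDiff_right_injective I.1 (hJ.trans hJ'.symm))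

/-! ### Multiplicities and invariants of a walk -/

/-- Add one to the multiplicity of `S`. -/
def visit (m : Subsets n r → ℕ) (S : Subsets n r) : Subsets n r → ℕ :=
  Function.update m S (m S + 1)

theorem sum_visit (g : Subsets n r → ℕ → ℕ) (m : Subsets n r → ℕ) (S : Subsets n r) :
    ∑ T, g T (visit m S T) + g S (m S) = ∑ T, g T (m T) + g S (m S + 1) := by
  rw [← Finset.add_sum_erase _ _ (Finset.mem_univ S),
    ← Finset.add_sum_erase _ (fun T => g T (m T)) (Finset.mem_univ S)]
  have : ∑ T ∈ Finset.univ.erase S, g T (visit m S T) = ∑ T ∈ Finset.univ.erase S, g T (m T) :=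
    Finset.sum_congr rfl fun T hT => by
      rw [visit, Function.update_of_ne (Finset.ne_of_mem_erase hT)]
  rw [this]
  simp only [visit, Function.update_self]
  ring

theorem prod_visit (g : Subsets n r → ℕ → ℝ) (m : Subsets n r → ℕ) (S : Subsets n r) (c : ℝ)
    (hc : g S (m S + 1) = g S (m S) * c) :
    ∏ T, g T (visit m S T) = (∏ T, g T (m T)) * c := by
  rw [← Finset.mul_prod_erase _ _ (Finset.mem_univ S),
    ← Finset.mul_prod_erase _ (fun T => g T (m T)) (Finset.mem_univ S)]
  have : ∏ T ∈ Finset.univ.erase S, g T (visit m S T) = ∏ T ∈ Finset.univ.erase S, g T (m T) :=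
    Finset.prod_congr rfl fun T hT => by
      rw [visit, Function.update_of_ne (Finset.ne_of_mem_erase hT)]
  rw [this]
  simp only [visit, Function.update_self, hc]
  ring

/-- The number of sets of odd multiplicity which contain `a`. -/
def oddDegree (m : Subsets n r → ℕ) (a : Fin n) : ℕ :=
  ∑ S : Subsets n r, if a ∈ S.1 ∧ Odd (m S) then 1 else 0

theorem oddDegree_visit_of_even {m : Subsets n r → ℕ} {S : Subsets n r} (hS : Even (m S))
    (a : Fin n) : oddDegree (visit m S) a = oddDegree m a + if a ∈ S.1 then 1 else 0 := by
  have h := sum_visit (fun T j => if a ∈ T.1 ∧ Odd j then 1 else 0) m S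
  have h1 : ¬ Odd (m S) := by simpa using hS
  have h2 : Odd (m S + 1) := hS.add_one
  simpa [h1, h2, oddDegree] using h

theorem oddDegree_visit_of_odd {m : Subsets n r → ℕ} {S : Subsets n r} (hS : Odd (m S))
    (a : Fin n) : oddDegree (visit m S) a + (if a ∈ S.1 then 1 else 0) = oddDegree m a := by
  have h := sum_visit (fun T j => if a ∈ T.1 ∧ Odd j then 1 else 0) m S
  have h2 : ¬ Odd (m S + 1) := by simpa using hS.add_one
  simpa [hS, h2, oddDegree] using h

/-- Invariants of a walk on the `ℓ`-element subsets: `m` counts the steps by their symmetric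
difference, `cur` is the current vertex, `seen` contains the elements met, and `b a` is the number
of times a step of previously even multiplicity brought in `a` when `a` had been met before. -/
structure WalkInvariant (m : Subsets n r → ℕ) (cur seen : Finset (Fin n)) (b : Fin n → ℕ) :
    Prop where
  support_subset : ∀ S, m S ≠ 0 → S.1 ⊆ seen
  oddDegree_le_of_mem : ∀ a ∈ cur, oddDegree m a ≤ 2 * b a + 1
  oddDegree_le_of_notMem : ∀ a ∉ cur, oddDegree m a ≤ 2 * b a + 2
  sum_excess_le : ∑ S, (m S - 1) / 2 ≤ ∑ a, b a

theorem WalkInvariant.init (I : Finset (Fin n)) :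
    WalkInvariant (0 : Subsets n r → ℕ) I I 0 where
  support_subset S h := absurd rfl h
  oddDegree_le_of_mem a _ := by simp [oddDegree]
  oddDegree_le_of_notMem a _ := by simp [oddDegree]
  sum_excess_le := by simp

/-- Add one to `b` on the set `E`. -/
def recordStep (b : Fin n → ℕ) (E : Finset (Fin n)) (a : Fin n) : ℕ :=
  b a + if a ∈ E then 1 else 0

theorem sum_recordStep (b : Fin n → ℕ) (E : Finset (Fin n)) :
    ∑ a, recordStep b E a = ∑ a, b a + E.card := by
  simp [recordStep, Finset.sum_add_distrib]

variable {m : Subsets n r → ℕ} {cur seen : Finset (Fin n)} {b : Fin n → ℕ}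

theorem WalkInvariant.support_visit (h : WalkInvariant m cur seen b) (S T : Subsets n r)
    (hT : visit m S T ≠ 0) : T.1 ⊆ seen ∪ S.1 := by
  by_cases hTS : T = S
  · subst hTS
    exact Finset.subset_union_right
  · rw [visit, Function.update_of_ne hTS] at hT
    exact (h.support_subset T hT).trans Finset.subset_union_left

/-- Closing `S` lowers the odd degree of its elements by one, which compensates for the tighter
bound on entering elements; the excess `(m S - 1) / 2` does not change. -/
theorem WalkInvariant.visit_of_odd (h : WalkInvariant m cur seen b) {S : Subsets n r}
    (hS : Odd (m S)) : WalkInvariant (visit m S) (symmDiff cur S.1) (seen ∪ S.1) b where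
  support_subset := h.support_visit S
  oddDegree_le_of_mem a ha := by
    have h0 := oddDegree_visit_of_odd hS a
    by_cases hc : a ∈ cur
    · have := h.oddDegree_le_of_mem a hc
      omega
    · have h1 := h.oddDegree_le_of_notMem a hc
      have h2 : a ∈ S.1 := by
        rcases Finset.mem_symmDiff.1 ha with ha | ha
        · exact absurd ha.1 hc
        · exact ha.1
      rw [if_pos h2] at h0
      omega
  oddDegree_le_of_notMem a ha := by
    have h0 := oddDegree_visit_of_odd hS a
    by_cases hc : a ∈ cur
    · have := h.oddDegree_le_of_mem a hc
      omega
    · have h1 := h.oddDegree_le_of_notMem a hc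
      omega
  sum_excess_le := by
    have h0 := sum_visit (fun _ j => (j - 1) / 2) m S
    have h1 := h.sum_excess_le
    obtain ⟨c, hc⟩ := hS
    omega

/-- Opening `S` raises the odd degree of its elements by one. A leaving element is covered by the
slack between the two bounds, a re-entering one by the increase of `b`, and a new one starts from
degree zero. -/
theorem WalkInvariant.visit_of_even (h : WalkInvariant m cur seen b) {S : Subsets n r}
    (hS : Even (m S)) (hne : (S.1 \ cur).Nonempty) :
    WalkInvariant (visit m S) (symmDiff cur S.1) (seen ∪ S.1)
      (recordStep b ((S.1 \ cur) ∩ seen)) where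
  support_subset := h.support_visit S
  oddDegree_le_of_mem a ha := by
    rw [oddDegree_visit_of_even hS, recordStep]
    rcases Finset.mem_symmDiff.1 ha with ⟨h1, h2⟩ | ⟨h1, h2⟩
    · have := h.oddDegree_le_of_mem a h1
      simp only [h2, if_false]
      omega
    · simp only [h1, if_true, Finset.mem_inter, Finset.mem_sdiff, h2, not_false_eq_true, true_and]
      split_ifs with hs
      · have := h.oddDegree_le_of_notMem a h2
        omega
      · have : oddDegree m a = 0 := by
          refine Finset.sum_eq_zero fun T _ => if_neg fun hT => hs ?_
          exact h.support_subset T (fun h0 => by simp [h0] at hT) hT.1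
        omega
  oddDegree_le_of_notMem a ha := by
    rw [oddDegree_visit_of_even hS, recordStep]
    rw [Finset.mem_symmDiff] at ha
    by_cases hc : a ∈ cur
    · have := h.oddDegree_le_of_mem a hc
      split_ifs <;> omega
    · have := h.oddDegree_le_of_notMem a hc
      rw [if_neg (fun h' => ha (Or.inr ⟨h', hc⟩))]
      omega
  sum_excess_le := by
    have h0 := sum_visit (fun _ j => (j - 1) / 2) m S
    have h1 := h.sum_excess_le
    rw [sum_recordStep]
    rcases Nat.eq_zero_or_pos (m S) with hz | hpos
    · rw [hz] at h0
      omega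
    -- The excess grows by one only when a set already used is reopened; all its elements have been
    -- met, so each entering one is recorded in `b`.
    · have h2 : 0 < ((S.1 \ cur) ∩ seen).card := by
        rw [Finset.card_pos]
        obtain ⟨a, ha⟩ := hne
        exact ⟨a, Finset.mem_inter.2
          ⟨ha, h.support_subset S hpos.ne' (Finset.mem_sdiff.1 ha).1⟩⟩
      obtain ⟨c, hc⟩ := hS
      omega

/-- Bound for the total multiplicity of the sets of odd multiplicity along which the walk can
move. -/
theorem WalkInvariant.sum_odd_le {k : ℕ} (hk : 0 < k) (hr : r = 2 * k)
    {I : Subsets n ℓ} (h : WalkInvariant m I.1 seen b) :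
    ∑ J : Subsets n ℓ, (if h : (symmDiff I.1 J.1).card = r then
      if Odd (m ⟨symmDiff I.1 J.1, h⟩) then m ⟨symmDiff I.1 J.1, h⟩ else 0 else 0) ≤
      ℓ + 4 * ∑ a, b a := by
  set f : Subsets n r → ℕ := fun S =>
    if (S.1 ∩ I.1).Nonempty ∧ Odd (m S) then m S else 0 with hf
  -- An odd multiplicity is `1 + 2 * ((m S - 1) / 2)`: the `1` is charged to an element of `S ∩ I`,
  -- the rest to the excess.
  have hpt : ∀ S : Subsets n r, f S ≤
      (∑ a ∈ I.1, if a ∈ S.1 ∧ Odd (m S) then 1 else 0) + 2 * ((m S - 1) / 2) := fun S => by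
    simp only [hf]
    split_ifs with hS
    · obtain ⟨⟨a, ha⟩, c, hc⟩ := hS
      rw [Finset.mem_inter] at ha
      have h1 := Finset.single_le_sum (f := fun a => if a ∈ S.1 ∧ Odd (m S) then 1 else 0)
        (fun _ _ => Nat.zero_le _) ha.2
      have h2 : Odd (m S) := ⟨c, hc⟩
      simp only [ha.1, h2, and_true, if_true] at h1
      simp only [h2, and_true]
      omega
    · exact Nat.zero_le _
  have step1 : ∀ J : Subsets n ℓ, (if h : (symmDiff I.1 J.1).card = r then
      if Odd (m ⟨symmDiff I.1 J.1, h⟩) then m ⟨symmDiff I.1 J.1, h⟩ else 0 else 0) ≤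
      if h : (symmDiff I.1 J.1).card = r then f ⟨symmDiff I.1 J.1, h⟩ else 0 := fun J => by
    by_cases h1 : (symmDiff I.1 J.1).card = r
    · rw [dif_pos h1, dif_pos h1]
      have h4 := (card_sdiff_of_card_symmDiff (I.2.trans J.2.symm) (h1.trans hr)).1
      have h5 : (I.1 \ J.1).Nonempty := by
        rw [← Finset.card_pos]
        omega
      have h6 : (symmDiff I.1 J.1 ∩ I.1).Nonempty := by
        obtain ⟨a, ha⟩ := h5
        rw [Finset.mem_sdiff] at ha
        exact ⟨a, Finset.mem_inter.2 ⟨Finset.mem_symmDiff.2 (Or.inl ha), ha.1⟩⟩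
      simp only [hf, h6, true_and, le_refl]
    · rw [dif_neg h1, dif_neg h1]
  refine (Finset.sum_le_sum fun J _ => step1 J).trans ((sum_neighbours_le I f).trans ?_)
  calc ∑ S, f S ≤ ∑ S : Subsets n r, ((∑ a ∈ I.1, if a ∈ S.1 ∧ Odd (m S) then 1 else 0) +
          2 * ((m S - 1) / 2)) := Finset.sum_le_sum fun S _ => hpt S
    _ = ∑ a ∈ I.1, oddDegree m a + 2 * ∑ S, (m S - 1) / 2 := by
        rw [Finset.sum_add_distrib, Finset.sum_comm, Finset.mul_sum]
        rfl
    _ ≤ ∑ a ∈ I.1, (2 * b a + 1) + 2 * ∑ a, b a :=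
        add_le_add (Finset.sum_le_sum h.oddDegree_le_of_mem)
          (Nat.mul_le_mul_left _ h.sum_excess_le)
    _ ≤ ℓ + 4 * ∑ a, b a := by
        rw [Finset.sum_add_distrib, ← Finset.mul_sum, Finset.sum_const, I.2]
        have : ∑ a ∈ I.1, b a ≤ ∑ a, b a :=
          Finset.sum_le_sum_of_subset (Finset.subset_univ _)
        simp only [smul_eq_mul]
        omega

end Kikuchi

namespace Kikuchi

/-! ### The trace moment -/

section Moment

variable {n r ℓ : ℕ} {Ω : Type*} [MeasurableSpace Ω] {P : Measure Ω} {G : Ω → Tensor n r}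

/-- The monomial with exponents `m` in the entries of a tensor. -/
noncomputable def monomial (m : Subsets n r → ℕ) (T : Tensor n r) : ℝ :=
  ∏ S, T.entry S ^ m S

theorem monomial_visit (m : Subsets n r → ℕ) (S : Subsets n r) (T : Tensor n r) :
    monomial (visit m S) T = monomial m T * T.entry S :=
  prod_visit (fun S j => T.entry S ^ j) m S _ (pow_succ _ _)

/-- Carrying the monomial of the past steps makes the walk expansion a recursion on the number of
steps left. -/
theorem monomial_mul_pow_succ (m : Subsets n r → ℕ) (T : Tensor n r) (j : ℕ) (I I₀ : Subsets n ℓ) :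
    monomial m T * (kikuchiMatrix ℓ T ^ (j + 1)) I I₀ =
      ∑ J : Subsets n ℓ, if h : (symmDiff I.1 J.1).card = r then
        monomial (visit m ⟨symmDiff I.1 J.1, h⟩) T * (kikuchiMatrix ℓ T ^ j) J I₀ else 0 := by
  rw [pow_succ', Matrix.mul_apply, Finset.mul_sum]
  refine Finset.sum_congr rfl fun J _ => ?_
  simp only [kikuchiMatrix, Matrix.of_apply]
  split_ifs with h
  · rw [monomial_visit]
    ring
  · ring

theorem integrable_monomial_mul_pow (hG : IsGaussianSymmetricTensor G P) (j : ℕ)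
    (m : Subsets n r → ℕ) (I I₀ : Subsets n ℓ) :
    Integrable (fun ω => monomial m (G ω) * (kikuchiMatrix ℓ (G ω) ^ j) I I₀) P := by
  induction j generalizing m I with
  | zero =>
    simp only [pow_zero]
    exact (integrable_prod_pow hG.hasLaw hG.indep m).mul_const _
  | succ j ih =>
    simp only [monomial_mul_pow_succ]
    refine integrable_finsetSum _ fun J _ => ?_
    split_ifs with h
    · exact ih _ _
    · exact integrable_zero _ _ _

theorem integral_monomial_mul_pow_succ (hG : IsGaussianSymmetricTensor G P) (m : Subsets n r → ℕ)
    (j : ℕ) (I I₀ : Subsets n ℓ) :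
    ∫ ω, monomial m (G ω) * (kikuchiMatrix ℓ (G ω) ^ (j + 1)) I I₀ ∂P =
      ∑ J : Subsets n ℓ, if h : (symmDiff I.1 J.1).card = r then
        ∫ ω, monomial (visit m ⟨symmDiff I.1 J.1, h⟩) (G ω) *
          (kikuchiMatrix ℓ (G ω) ^ j) J I₀ ∂P else 0 := by
  simp only [monomial_mul_pow_succ]
  rw [integral_finsetSum]
  · refine Finset.sum_congr rfl fun J _ => ?_
    split_ifs with h
    · rfl
    · simp
  · intro J _
    split_ifs with h
    · exact integrable_monomial_mul_pow hG _ _ _ _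
    · exact integrable_zero _ _ _

theorem prod_momentWeight_visit {x : ℝ} (m : Subsets n r → ℕ) (S : Subsets n r) :
    ∏ T, momentWeight x (visit m S T) =
      (∏ T, momentWeight x (m T)) * if Even (m S) then x else m S / x :=
  prod_visit (fun _ j => momentWeight x j) m S _ rfl

/-- The factor `y ^ (F * j)`, with `F = ∑ a, b a`, reserves one `y ^ F` for each of the `j` steps
left, to pay for a closing step. A re-entry raises `F` by one and so costs `y ^ j ≤ Z`, absorbed by
the weighted count of neighbours. -/
theorem integral_monomial_mul_pow_le (hG : IsGaussianSymmetricTensor G P) {k K V : ℕ} (hk : 0 < k)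
    (hr : r = 2 * k) {x y s Z : ℝ} (hx : 0 < x) (hy : 1 ≤ y) (hs : 0 ≤ s) (hyZ : y ^ K ≤ Z)
    (hopen : x * ((ℓ : ℝ) ^ k * (n + V * Z) ^ k) ≤ s) (hclose : ℓ / x ≤ s)
    (hyℓ : ∀ F : ℕ, (ℓ : ℝ) + 4 * F ≤ ℓ * y ^ F) (I₀ : Subsets n ℓ) (j : ℕ)
    (m : Subsets n r → ℕ) (I : Subsets n ℓ) (seen : Finset (Fin n)) (b : Fin n → ℕ)
    (hinv : WalkInvariant m I.1 seen b) (hseen : seen.card + r * j ≤ V) (hj : j ≤ K) :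
    ∫ ω, monomial m (G ω) * (kikuchiMatrix ℓ (G ω) ^ j) I I₀ ∂P ≤
      (∏ S, momentWeight x (m S)) * y ^ ((∑ a, b a) * j) * (2 * s) ^ j := by
  have hy0 : 0 < y := by linarith
  induction j generalizing m I seen b with
  | zero =>
    obtain ⟨h0, h1⟩ := integral_prod_pow_mem hG.hasLaw hG.indep m hx
    simp only [pow_zero, mul_zero, mul_one, Matrix.one_apply, integral_mul_const]
    split_ifs with hI
    · rwa [mul_one]
    · rw [mul_zero]
      exact h0.trans h1
  | succ j ih =>
    set W := ∏ S, momentWeight x (m S) with hW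
    have hW0 : 0 ≤ W := Finset.prod_nonneg fun S _ => momentWeight_nonneg hx _
    set F := ∑ a, b a with hF
    -- The first summand bounds opening steps, the second closing steps.
    have hterm : ∀ J : Subsets n ℓ, (if h : (symmDiff I.1 J.1).card = r then
        ∫ ω, monomial (visit m ⟨symmDiff I.1 J.1, h⟩) (G ω) *
          (kikuchiMatrix ℓ (G ω) ^ j) J I₀ ∂P else 0) ≤
        W * (2 * s) ^ j * y ^ (F * j) * x *
          (if (symmDiff I.1 J.1).card = 2 * k then (y ^ j) ^ ((J.1 \ I.1) ∩ seen).card else 0) +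
        W * (2 * s) ^ j * y ^ (F * j) / x *
          ((if h : (symmDiff I.1 J.1).card = r then if Odd (m ⟨symmDiff I.1 J.1, h⟩) then
            m ⟨symmDiff I.1 J.1, h⟩ else 0 else 0 : ℕ) : ℝ) := fun J => by
      by_cases h : (symmDiff I.1 J.1).card = r
      · rw [dif_pos h, dif_pos h, if_pos (h.trans hr)]
        set S : Subsets n r := ⟨symmDiff I.1 J.1, h⟩ with hS
        have hcur : symmDiff I.1 S.1 = J.1 := symmDiff_symmDiff_cancel_left _ _
        have hdiff : S.1 \ I.1 = J.1 \ I.1 := by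
          ext a
          simp only [hS, Finset.mem_sdiff, Finset.mem_symmDiff]
          tauto
        have hcard : (seen ∪ S.1).card + r * j ≤ V := by
          have := Finset.card_union_le seen S.1
          rw [S.2] at this
          linarith
        rcases Nat.even_or_odd (m S) with he | ho
        · have hne : (S.1 \ I.1).Nonempty := by
            rw [hdiff, ← Finset.card_pos,
              (card_sdiff_of_card_symmDiff (I.2.trans J.2.symm) (h.trans hr)).2]
            exact hk
          have hinv' := hinv.visit_of_even he hne
          rw [hcur] at hinv'
          refine (ih _ J _ _ hinv' hcard (by omega)).trans ?_
          rw [prod_momentWeight_visit, if_pos he, sum_recordStep, hdiff,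
            if_neg (by simpa using he)]
          apply le_of_eq
          rw [add_mul, pow_add, mul_comm _ j, mul_comm _ j, pow_mul y j (Finset.card _)]
          push_cast
          ring
        · have hinv' := hinv.visit_of_odd ho
          rw [hcur] at hinv'
          refine (ih _ J _ _ hinv' hcard (by omega)).trans ?_
          rw [prod_momentWeight_visit, if_neg (by simpa using ho), if_pos ho]
          have h1 : W * (m S / x) * y ^ (F * j) * (2 * s) ^ j =
              W * (2 * s) ^ j * y ^ (F * j) / x * m S := by ring
          rw [h1]
          refine le_add_of_nonneg_left ?_
          positivity
      · have h' : ¬ (symmDiff I.1 J.1).card = 2 * k := fun h' => h (h'.trans hr.symm)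
        rw [dif_neg h, dif_neg h, if_neg h']
        simp
    have hj1 : 1 ≤ y ^ j := one_le_pow₀ hy
    have hjZ : y ^ j ≤ Z := (pow_le_pow_right₀ hy (by omega)).trans hyZ
    have hsum1 : ∑ J : Subsets n ℓ, (if (symmDiff I.1 J.1).card = 2 * k then
        (y ^ j) ^ ((J.1 \ I.1) ∩ seen).card else 0) ≤ (ℓ : ℝ) ^ k * (n + V * Z) ^ k := by
      refine (sum_neighbours_pow_le I seen hj1).trans ?_
      have : (seen.card : ℝ) ≤ V := by exact_mod_cast (by omega : seen.card ≤ V)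
      have h0 : 0 ≤ y ^ j := by positivity
      gcongr
    have hsum2 : ∑ J : Subsets n ℓ, ((if h : (symmDiff I.1 J.1).card = r then
        if Odd (m ⟨symmDiff I.1 J.1, h⟩) then m ⟨symmDiff I.1 J.1, h⟩ else 0 else 0 : ℕ) : ℝ) ≤
        ℓ * y ^ F := by
      refine le_trans ?_ (hyℓ F)
      exact_mod_cast hinv.sum_odd_le hk hr
    have hyF : 1 ≤ y ^ F := one_le_pow₀ hy
    rw [integral_monomial_mul_pow_succ hG]
    refine (Finset.sum_le_sum fun J _ => hterm J).trans ?_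
    rw [Finset.sum_add_distrib, ← Finset.mul_sum, ← Finset.mul_sum]
    have hA : 0 ≤ W * (2 * s) ^ j * y ^ (F * j) := by positivity
    calc _ ≤ W * (2 * s) ^ j * y ^ (F * j) * x * ((ℓ : ℝ) ^ k * (n + V * Z) ^ k) +
          W * (2 * s) ^ j * y ^ (F * j) / x * (ℓ * y ^ F) := by gcongr
      _ = W * (2 * s) ^ j * y ^ (F * j) * (x * ((ℓ : ℝ) ^ k * (n + V * Z) ^ k) +
          ℓ / x * y ^ F) := by ring
      _ ≤ W * (2 * s) ^ j * y ^ (F * j) * (s * y ^ F + s * y ^ F) := by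
          refine mul_le_mul_of_nonneg_left (add_le_add ?_ ?_) hA
          · exact hopen.trans (le_mul_of_one_le_right hs hyF)
          · exact mul_le_mul_of_nonneg_right hclose (by positivity)
      _ = _ := by
          rw [mul_add F j 1, pow_add, mul_one]
          ring

theorem integrable_trace_pow (hG : IsGaussianSymmetricTensor G P) (j : ℕ) :
    Integrable (fun ω => (kikuchiMatrix ℓ (G ω) ^ j).trace) P := by
  simp only [Matrix.trace, Matrix.diag_apply]
  refine integrable_finsetSum _ fun I _ => ?_
  simpa [monomial] using integrable_monomial_mul_pow hG j 0 I I

/-- The trace moment bound for the Kikuchi matrix. -/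
theorem integral_trace_pow_le (hG : IsGaussianSymmetricTensor G P) {k K V : ℕ} (hk : 0 < k)
    (hr : r = 2 * k) (hℓ : 0 < ℓ) (hn : 0 < n) {y Z : ℝ} (hy : 1 ≤ y) (hyZ : y ^ K ≤ Z)
    (hVZ : V * Z ≤ n) (hyℓ : ∀ F : ℕ, (ℓ : ℝ) + 4 * F ≤ ℓ * y ^ F) (hV : ℓ + r * K ≤ V) :
    ∫ ω, (kikuchiMatrix ℓ (G ω) ^ K).trace ∂P ≤
      (n : ℝ) ^ ℓ * (2 * √(ℓ * (ℓ ^ k * (2 * n) ^ k))) ^ K := by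
  have hℓ' : (0 : ℝ) < ℓ := by exact_mod_cast hℓ
  have hn' : (0 : ℝ) < n := by exact_mod_cast hn
  set D : ℝ := (ℓ : ℝ) ^ k * (2 * n) ^ k with hD
  have hD0 : 0 < D := by positivity
  set s := √(ℓ * D) with hs
  have hs0 : 0 < s := Real.sqrt_pos.2 (by positivity)
  have hss : s * s = ℓ * D := Real.mul_self_sqrt (by positivity)
  have hZ : 0 ≤ Z := le_trans (by positivity) hyZ
  -- The choice `x = s / D` balances the opening cost `x * D` and the closing cost `ℓ / x`: both
  -- equal `s`.
  have hx : 0 < s / D := by positivity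
  have hopen : s / D * ((ℓ : ℝ) ^ k * (n + V * Z) ^ k) ≤ s := by
    calc _ ≤ s / D * D := by
          rw [hD]
          gcongr
          linarith
      _ = s := by field_simp
  have hclose : ℓ / (s / D) ≤ s := by
    rw [div_div_eq_mul_div, ← hss, mul_div_assoc, div_self hs0.ne', mul_one]
  have hdiag : ∀ I : Subsets n ℓ,
      ∫ ω, (kikuchiMatrix ℓ (G ω) ^ K) I I ∂P ≤ (2 * s) ^ K := fun I => by
    have h := integral_monomial_mul_pow_le hG hk hr hx hy hs0.le hyZ hopen hclose hyℓ I K 0 I I.1 0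
      (WalkInvariant.init _) (by rw [I.2]; exact hV) le_rfl
    simpa [monomial, momentWeight] using h
  simp only [Matrix.trace, Matrix.diag_apply]
  rw [integral_finsetSum _ fun I _ => by
    simpa [monomial] using integrable_monomial_mul_pow hG K 0 I I]
  refine (Finset.sum_le_sum fun I _ => hdiag I).trans ?_
  rw [Finset.sum_const, nsmul_eq_mul, Finset.card_univ]
  have hcard : (Fintype.card (Subsets n ℓ) : ℝ) ≤ (n : ℝ) ^ ℓ := by
    rw [Fintype.card_finset_len, Fintype.card_fin]
    exact_mod_cast Nat.choose_le_pow n ℓ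
  gcongr

theorem kikuchiMatrix_isSymm (T : Tensor n r) : (kikuchiMatrix ℓ T).IsSymm := by
  ext I J
  simp only [Matrix.transpose_apply, kikuchiMatrix, Matrix.of_apply, symmDiff_comm J.1 I.1]

/-- Tail bound for the spectral norm of the Kikuchi matrix, by Markov's inequality. -/
theorem measureReal_specNorm_gt_le (hG : IsGaussianSymmetricTensor G P) {k p V : ℕ} (hk : 0 < k)
    (hp : 0 < p) (hr : r = 2 * k) (hℓ : 0 < ℓ) (hn : 0 < n) {y Z : ℝ} (hy : 1 ≤ y)
    (hyZ : y ^ (2 * p) ≤ Z) (hVZ : V * Z ≤ n) (hyℓ : ∀ F : ℕ, (ℓ : ℝ) + 4 * F ≤ ℓ * y ^ F)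
    (hV : ℓ + r * (2 * p) ≤ V) {C : ℝ} (hC : 0 < C) :
    P.real {ω | C * √((n : ℝ) * ℓ) ^ k * √ℓ < specNorm (kikuchiMatrix ℓ (G ω))} ≤
      (n : ℝ) ^ ℓ * (4 * 2 ^ k / C ^ 2) ^ p := by
  have := hG.indep.isProbabilityMeasure
  have hℓ' : (0 : ℝ) < ℓ := by exact_mod_cast hℓ
  have hn' : (0 : ℝ) < n := by exact_mod_cast hn
  set t := C * √((n : ℝ) * ℓ) ^ k * √ℓ with ht
  have ht0 : 0 < t := by positivity
  have htr : ∀ ω, specNorm (kikuchiMatrix ℓ (G ω)) ^ (2 * p) ≤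
      (kikuchiMatrix ℓ (G ω) ^ (2 * p)).trace := fun ω =>
    specNorm_pow_le_trace (kikuchiMatrix_isSymm _) hp
  have hmarkov := mul_meas_ge_le_integral_of_nonneg (μ := P)
    (f := fun ω => (kikuchiMatrix ℓ (G ω) ^ (2 * p)).trace)
    (Eventually.of_forall fun ω => (pow_nonneg (norm_nonneg _) _).trans (htr ω))
    (integrable_trace_pow hG _) (t ^ (2 * p))
  have hsub : P.real {ω | t < specNorm (kikuchiMatrix ℓ (G ω))} ≤
      P.real {ω | t ^ (2 * p) ≤ (kikuchiMatrix ℓ (G ω) ^ (2 * p)).trace} :=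
    measureReal_mono fun ω hω => (pow_le_pow_left₀ ht0.le (le_of_lt hω) _).trans (htr ω)
  have hint := integral_trace_pow_le hG hk hr hℓ hn hy hyZ hVZ hyℓ hV
  have ht2 : t ^ 2 = C ^ 2 * (((n : ℝ) * ℓ) ^ k * ℓ) := by
    rw [ht, mul_pow, mul_pow, ← pow_mul, mul_comm k 2, pow_mul, Real.sq_sqrt (by positivity),
      Real.sq_sqrt hℓ'.le]
    ring
  have hs2 : (2 * √(ℓ * ((ℓ : ℝ) ^ k * (2 * n) ^ k))) ^ 2 = 4 * 2 ^ k / C ^ 2 * t ^ 2 := by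
    rw [mul_pow, Real.sq_sqrt (by positivity), ht2, mul_pow, mul_pow]
    field_simp
    ring
  rw [pow_mul _ 2 p, hs2, mul_pow, ← pow_mul t, ← mul_assoc] at hint
  refine hsub.trans (le_of_mul_le_mul_left ((hmarkov.trans hint).trans_eq ?_)
    (pow_pos ht0 (2 * p)))
  ring

end Moment

end Kikuchi

/-! ### Choice of parameters and conclusion -/

namespace Kikuchi

theorem specNorm_kikuchiMatrix_zero {n r : ℕ} (hr : 0 < r) (T : Tensor n r) :
    specNorm (kikuchiMatrix 0 T) = 0 := by
  have h : kikuchiMatrix 0 T = 0 := by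
    ext I J
    have hI : I.1 = ∅ := Finset.card_eq_zero.1 I.2
    have hJ : J.1 = ∅ := Finset.card_eq_zero.1 J.2
    simp [kikuchiMatrix, hI, hJ, hr.ne]
  rw [specNorm, h, map_zero, norm_zero]

/-- The length scale of the moment method: the trace moment is of order `2 * ℓ * momentScale n`. -/
noncomputable def momentScale (n : ℕ) : ℕ := ⌊Real.log n / 16⌋₊

theorem tendsto_momentScale : Tendsto momentScale atTop atTop :=
  tendsto_nat_floor_atTop.comp
    ((Real.tendsto_log_atTop.comp tendsto_natCast_atTop_atTop).atTop_div_const (by norm_num))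

theorem eventually_momentScale_le (r : ℕ) :
    ∀ᶠ n : ℕ in atTop, 1 + 2 * r * (momentScale n : ℝ) ≤ (n : ℝ) ^ (1 / 4 : ℝ) := by
  have h1 : ∀ᶠ x : ℝ in atTop, 1 + r / 8 * Real.log x ≤ x ^ (1 / 4 : ℝ) := by
    have ho : (fun x : ℝ => 1 + r / 8 * Real.log x) =o[atTop] fun x : ℝ => x ^ (1 / 4 : ℝ) :=
      ((Asymptotics.isLittleO_const_left.2 (Or.inr
        (tendsto_norm_atTop_atTop.comp (tendsto_rpow_atTop (by norm_num))))).add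
        ((isLittleO_log_rpow_atTop (by norm_num)).const_mul_left _))
    filter_upwards [ho.bound one_pos, eventually_ge_atTop 0] with x hx h0
    rw [one_mul, Real.norm_eq_abs, Real.norm_of_nonneg (Real.rpow_nonneg h0 _)] at hx
    exact (le_abs_self _).trans hx
  filter_upwards [tendsto_natCast_atTop_atTop.eventually h1] with n hn
  refine le_trans ?_ hn
  have h2 : (momentScale n : ℝ) ≤ Real.log n / 16 :=
    Nat.floor_le (div_nonneg (Real.log_natCast_nonneg n) (by norm_num))
  have h3 : 2 * (r : ℝ) * momentScale n ≤ 2 * r * (Real.log n / 16) := by gcongr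
  linarith

theorem measureReal_specNorm_gt_le_exp {n r ℓ k : ℕ} {Ω : Type*} [MeasurableSpace Ω]
    {P : Measure Ω} {G : Ω → Tensor n r} (hG : IsGaussianSymmetricTensor G P) (hk : 0 < k)
    (hr : r = 2 * k) (hℓ : 0 < ℓ) (hn : 0 < n) (hℓn : (ℓ : ℝ) ≤ (n : ℝ) ^ (1 / 4 : ℝ))
    (hL : 1 ≤ momentScale n) (hLn : 1 + 2 * r * (momentScale n : ℝ) ≤ (n : ℝ) ^ (1 / 4 : ℝ)) :
    P.real {ω | √(4 * 2 ^ k * Real.exp 33) * √((n : ℝ) * ℓ) ^ k * √ℓ <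
      specNorm (kikuchiMatrix ℓ (G ω))} ≤ Real.exp (-momentScale n) := by
  set L := momentScale n with hLdef
  have hℓ' : (0 : ℝ) < ℓ := by exact_mod_cast hℓ
  have hℓ1 : (1 : ℝ) ≤ ℓ := by exact_mod_cast hℓ
  have hL1 : (1 : ℝ) ≤ L := by exact_mod_cast hL
  have hn' : (0 : ℝ) < n := by exact_mod_cast hn
  have hlog : (L : ℝ) ≤ Real.log n / 16 :=
    Nat.floor_le (div_nonneg (Real.log_natCast_nonneg n) (by norm_num))
  have hlog' : Real.log n / 16 < L + 1 := Nat.lt_floor_add_one _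
  -- Here `p = ℓ * L`, `y = exp (4 / ℓ)` and `Z = n ^ (1 / 2)`. The power of `y` is `exp (8 * L)`,
  -- which is why `momentScale` divides `log n` by `16`.
  have hyZ : Real.exp (4 / ℓ) ^ (2 * (ℓ * L)) ≤ (n : ℝ) ^ (1 / 2 : ℝ) := by
    rw [← Real.exp_nat_mul, Real.rpow_def_of_pos hn']
    refine Real.exp_le_exp.2 ?_
    push_cast
    have : 2 * ((ℓ : ℝ) * L) * (4 / ℓ) = 8 * L := by field_simp; norm_num
    rw [this]
    linarith
  have hVZ : ((ℓ + r * (2 * (ℓ * L)) : ℕ) : ℝ) * (n : ℝ) ^ (1 / 2 : ℝ) ≤ n := by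
    calc ((ℓ + r * (2 * (ℓ * L)) : ℕ) : ℝ) * (n : ℝ) ^ (1 / 2 : ℝ) =
          ℓ * (1 + 2 * r * (L : ℝ)) * (n : ℝ) ^ (1 / 2 : ℝ) := by push_cast; ring
      _ ≤ (n : ℝ) ^ (1 / 4 : ℝ) * (n : ℝ) ^ (1 / 4 : ℝ) * (n : ℝ) ^ (1 / 2 : ℝ) := by gcongr
      _ = n := by
        rw [← Real.rpow_add hn', ← Real.rpow_add hn']
        norm_num
  have hyℓ : ∀ F : ℕ, (ℓ : ℝ) + 4 * F ≤ ℓ * Real.exp (4 / ℓ) ^ F := fun F => by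
    rw [← Real.exp_nat_mul]
    calc (ℓ : ℝ) + 4 * F = ℓ * (F * (4 / ℓ) + 1) := by field_simp; ring
      _ ≤ _ := mul_le_mul_of_nonneg_left (Real.add_one_le_exp _) hℓ'.le
  refine (measureReal_specNorm_gt_le hG hk (Nat.mul_pos hℓ hL) hr hℓ hn
    (Real.one_le_exp (by positivity)) hyZ hVZ hyℓ le_rfl (by positivity)).trans ?_
  have hbase : 4 * 2 ^ k / √(4 * 2 ^ k * Real.exp 33) ^ 2 = Real.exp (-33) := by
    rw [Real.sq_sqrt (by positivity), Real.exp_neg]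
    field_simp
  have hnexp : (n : ℝ) ^ ℓ = Real.exp (ℓ * Real.log n) := by
    rw [Real.exp_nat_mul, Real.exp_log hn']
  rw [hbase, hnexp, ← Real.exp_nat_mul, ← Real.exp_add]
  refine Real.exp_le_exp.2 ?_
  push_cast
  -- Since `log n < 16 * (L + 1) ≤ 32 * L`, the exponent `33` in the constant beats `n ^ ℓ` and
  -- leaves `exp (-ℓ * L)`.
  have h1 : Real.log n ≤ 32 * L := by linarith
  have h2 : (ℓ : ℝ) * Real.log n ≤ ℓ * (32 * L) := mul_le_mul_of_nonneg_left h1 hℓ'.le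
  have h3 : (L : ℝ) ≤ ℓ * L := le_mul_of_one_le_left (by linarith) hℓ1
  linarith

end Kikuchi

theorem mainTheorem1 (r : ℕ) (hr : Even r) (hr2 : 2 < r) :
    ∃ δ : ℝ, 0 < δ ∧ ∃ C : ℝ, 0 < C ∧ ∃ ε : ℕ → ℝ, Tendsto ε atTop (𝓝 0) ∧
      ∀ (n ℓ : ℕ), (ℓ : ℝ) < (n : ℝ) ^ δ →
        ∀ (Ω : Type*) [MeasurableSpace Ω] (P : Measure Ω) [IsProbabilityMeasure P]
          (G : Ω → Kikuchi.Tensor n r), Kikuchi.IsGaussianSymmetricTensor G P →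
          1 - ε n ≤ P.real {ω | Kikuchi.specNorm (Kikuchi.kikuchiMatrix ℓ (G ω)) ≤
            C * Real.sqrt ((n : ℝ) * (ℓ : ℝ)) ^ (r / 2) * Real.sqrt (ℓ : ℝ)} := by
  classical
  obtain ⟨k, hk⟩ := hr
  have hrk : r = 2 * k := by omega
  have hk0 : 0 < k := by omega
  have hr2k : r / 2 = k := by omega
  let good : ℕ → Prop := fun n => 0 < n ∧ 1 ≤ Kikuchi.momentScale n ∧
    1 + 2 * r * (Kikuchi.momentScale n : ℝ) ≤ (n : ℝ) ^ (1 / 4 : ℝ)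
  have hgood : ∀ᶠ n in atTop, good n := by
    filter_upwards [eventually_gt_atTop 0, Kikuchi.tendsto_momentScale.eventually_ge_atTop 1,
      Kikuchi.eventually_momentScale_le r] with n h1 h2 h3 using ⟨h1, h2, h3⟩
  -- The value `1` of `ε` at the remaining `n` makes the claim trivial there.
  refine ⟨1 / 4, by norm_num, √(4 * 2 ^ k * Real.exp 33), by positivity,
    fun n => if good n then Real.exp (-Kikuchi.momentScale n) else 1, ?_, ?_⟩
  · have h : Tendsto (fun n => Real.exp (-(Kikuchi.momentScale n : ℝ))) atTop (𝓝 0) :=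
      Real.tendsto_exp_neg_atTop_nhds_zero.comp
        (tendsto_natCast_atTop_atTop.comp Kikuchi.tendsto_momentScale)
    refine h.congr' ?_
    filter_upwards [hgood] with n hn
    rw [if_pos hn]
  · intro n ℓ hℓn Ω _ P _ G hG
    rw [hr2k]
    -- For `ℓ = 0` the moment exponent `ℓ * L` would vanish, but the matrix is zero.
    rcases Nat.eq_zero_or_pos ℓ with rfl | hℓ
    · have h : {ω | Kikuchi.specNorm (Kikuchi.kikuchiMatrix 0 (G ω)) ≤
          √(4 * 2 ^ k * Real.exp 33) * √((n : ℝ) * (0 : ℕ)) ^ k * √(0 : ℕ)} = Set.univ := by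
        ext ω
        simp [Kikuchi.specNorm_kikuchiMatrix_zero (by omega : 0 < r)]
      rw [h, probReal_univ, sub_le_self_iff]
      beta_reduce
      split_ifs <;> positivity
    beta_reduce
    split_ifs with hn
    · have hbad := Kikuchi.measureReal_specNorm_gt_le_exp hG hk0 hrk hℓ hn.1 hℓn.le hn.2.1 hn.2.2
      rw [sub_le_iff_le_add]
      refine le_trans ?_ (add_le_add_right hbad _)
      refine le_trans (le_of_eq ?_) (measureReal_union_le _ _)
      rw [← probReal_univ (μ := P)]
      congr 1
      ext ω
      simp [le_or_gt]
    · rw [sub_self]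
      exact measureReal_nonneg
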